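/- **Model.** Let $n\ge 3$ and let $A=[a_{ij}]\in\mathbb R^{n\times n}$ be a (row-)stochastic matrix. The underlying digraph $\mathcal G_0=\mathcal G_A=(\{1,\dots,n\},\mathcal E_0)$ has the arc $(j,i)$ if and only if $a_{ij}>0$. At each time $k=0,1,2,\dots$ an ordered pair is selected: a node $i$ is drawn with probability $1/n$ and picks the pair $(i,j)$ with probability $a_{ij}$. Let $P_k^+,P_k^-\in[0,1]$ be deterministic sequences. When $(i,j)$ is selected at time $k$, $\mathbb E_k^+$ is the event that $i$ receives $x_j(k)$, $\mathbb E_k^-$ is the event that $j$ receives $x_i(k)$, and $\mathbf P(\mathbb E_k^\pm)=P_k^\pm$. Selections and communications at different times are independent, and at each time the pair $(\mathbb E_k^+,\mathbb E_k^-)$ is independent of the selection. A node that receives the other node's state replaces its own state by the average $\frac12(x_i(k)+x_j(k))$; every other node keeps its state. The algorithm is started at an arbitrary integer time $k_0\ge0$ with arbitrary deterministic states $x(k_0)\in\mathbb R^n$. Let $\mathcal H(k)=\max_i x_i(k)-\min_i x_i(k)$ and $$T_{\rm com}(\epsilon)=\sup_{k_0\ge 0,\;x(k_0):\,\mathcal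 H(k_0)>0}\ \inf\Big\{k-k_0:\ k\ge k_0,\ \mathbf P\Big(\frac{\mathcal H(k)}{\mathcal H(k_0)}\ge\epsilon\Big)\le\epsilon\Big\}\in\mathbb N\cup\{\infty\}.$$ Global a.s. $\epsilon$-consensus is achieved if $T_{\rm com}(\epsilon)=O(\log\epsilon^{-1})$, by which it is meant that $\limsup_{\epsilon\to0^+}T_{\rm com}(\epsilon)/\log\epsilon^{-1}$ is finite and nonzero. **Theorem 5.** Suppose that the events $\mathbb E_k^+$ and $\mathbb E_k^-$ are independent for every $k$ (A3), and that both $\mathcal G_0$ and its converse $\mathcal G_0^T$ (all arcs reversed) are quasi-strongly connected, i.e. each of them has a node from which every node is reachable (A4). Then global a.s. $\epsilon$-consensus is achieved if and only if there exist a constant $p_*>0$ and an integer $T_*\ge1$ such that $$\sum_{k=m}^{m+T_*-1}\big(P_k^++P_k^-\big)\ge p_*\qquad\text{for all } m\ge0. \tag{1}$$ Moreover, for all $p_*>0$ and $T_*\ge1$ that satisfy (1), there is a constant $C$ such that for all $\epsilon\in(0,1)$ $$T_{\rm com}(\epsilon)\le\frac{4T_*\theta_0/p_*}{\log\big(1-(\frac{a_*}{4n})^{\theta_0}\big)^{-1}}\,\log\epsilon^{-1}+C,\qquad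 \theta_0=(2d_*-1)(2E_*-1).$$ Here $d_*=\max\{\mathrm{diam}(\mathcal G_A),\mathrm{diam}(\mathcal G_{A^T})\}$, the diameter of a digraph being the largest distance from $i$ to $j$ over all pairs with $j$ reachable from $i$; $E_*$ is the number of arcs in $\mathcal E_0$ that are not self-loops; and $a_*=\min\{a_{ij}:\ a_{ij}>0,\ i\ne j\}$. -/

import Mathlib

open MeasureTheory ProbabilityTheory Filter Topology
open scoped ENNReal

namespace Gossip

/-! ### Directed graphs -/

/-- `ArcPath G i j k`: there is a directed path of length `k` (that is, with `k` arcs) from `i`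
to `j` in `G`. Every node has a path of length `0` to itself. -/
inductive ArcPath {V : Type*} (G : Digraph V) : V → V → ℕ → Prop
  | nil (i : V) : ArcPath G i i 0
  | cons {i j l : V} {k : ℕ} (h : G.Adj i j) (p : ArcPath G j l k) : ArcPath G i l (k + 1)

/-- `j` is reachable from `i`. -/
def Reachable {V : Type*} (G : Digraph V) (i j : V) : Prop := ∃ k, ArcPath G i j k

/-- `G` is quasi-strongly connected: it has a center, a node from which every node is reachable. -/
def QuasiStronglyConnected {V : Type*} (G : Digraph V) : Prop := ∃ c, ∀ j, Reachable G c j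

/-- The converse graph, with all arcs reversed. -/
def converse {V : Type*} (G : Digraph V) : Digraph V where
  Adj i j := G.Adj j i

/-- The distance from `i` to `j`, the length of a shortest path (used for reachable `j` only). -/
noncomputable def dist {V : Type*} (G : Digraph V) (i j : V) : ℕ := sInf {k | ArcPath G i j k}

open Classical in
/-- The diameter: the largest distance from `i` to `j`, over all `i`, `j` with `j` reachable
from `i`. -/
noncomputable def diam {V : Type*} [Fintype V] (G : Digraph V) : ℕ :=
  (Finset.univ.filter fun e : V × V => Reachable G e.1 e.2).sup fun e => dist G e.1 e.2

/-- The induced graph of a matrix `M` with nonnegative entries: `(j, i)` is an arc if and only if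
`M i j > 0`. -/
def inducedGraph {n : ℕ} (M : Matrix (Fin n) (Fin n) ℝ) : Digraph (Fin n) where
  Adj j i := 0 < M i j

/-- Double connectivity: the underlying graph (the induced graph of `A`) and its converse are both
quasi-strongly connected. -/
def DoublyConnected {n : ℕ} (A : Matrix (Fin n) (Fin n) ℝ) : Prop :=
  QuasiStronglyConnected (inducedGraph A) ∧ QuasiStronglyConnected (converse (inducedGraph A))

/-- `d_*`, the larger of the diameters of the induced graphs of `A` and of its transpose. -/
noncomputable def dStar {n : ℕ} (A : Matrix (Fin n) (Fin n) ℝ) : ℕ :=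
  max (diam (inducedGraph A)) (diam (inducedGraph A.transpose))

open Classical in
/-- `E_*`, the number of arcs of the underlying graph that are not self-loops. -/
noncomputable def eStar {n : ℕ} (A : Matrix (Fin n) (Fin n) ℝ) : ℕ :=
  (Finset.univ.filter fun e : Fin n × Fin n => (inducedGraph A).Adj e.1 e.2 ∧ e.1 ≠ e.2).card

/-- `a_*`, the smallest nonzero off-diagonal entry of `A`. -/
noncomputable def aStar {n : ℕ} (A : Matrix (Fin n) (Fin n) ℝ) : ℝ :=
  sInf {a | ∃ i j, i ≠ j ∧ 0 < A i j ∧ a = A i j}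

/-- `θ₀ = (2 d_* - 1) (2 E_* - 1)`. (Under double connectivity with at least two nodes, `d_*` and
`E_*` are at least `1`, so that the subtractions are not truncated.) -/
noncomputable def thetaZero {n : ℕ} (A : Matrix (Fin n) (Fin n) ℝ) : ℕ :=
  (2 * dStar A - 1) * (2 * eStar A - 1)

/-! ### The random processes -/

/-- The node pair selection process: `sel k = (i, j)` means that pair `(i, j)` is selected at time
`k`, node `i` being drawn with probability `1 / n` and then picking `j` with probability `A i j`.
`recvPlus k = true` is the event `E_k^+` that the first node `i` of the selected pair
`(i, j)` receives the state of `j`, and `recvMinus k = true` is the event `E_k^-` that the second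
node `j` receives the state of `i`. Their probabilities are `Pplus k` and `Pminus k`. What happens
at different times is independent, and at each time the pair of communication events is
independent of the node pair selection; the dependence between `E_k^+` and `E_k^-` is left open. -/
structure IsGossipProcess {n : ℕ} (A : Matrix (Fin n) (Fin n) ℝ) (Pplus Pminus : ℕ → ℝ)
    {Ω : Type*} [MeasurableSpace Ω] (μ : Measure Ω) (sel : ℕ → Ω → Fin n × Fin n)
    (recvPlus recvMinus : ℕ → Ω → Bool) : Prop where
  measurable_sel : ∀ k, Measurable (sel k)
  measurable_recvPlus : ∀ k, Measurable (recvPlus k)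
  measurable_recvMinus : ∀ k, Measurable (recvMinus k)
  law_sel : ∀ k i j, μ.real {ω | sel k ω = (i, j)} = 1 / (n : ℝ) * A i j
  law_recvPlus : ∀ k, μ.real {ω | recvPlus k ω = true} = Pplus k
  law_recvMinus : ∀ k, μ.real {ω | recvMinus k ω = true} = Pminus k
  indep_time : iIndepFun (fun k ω => (sel k ω, recvPlus k ω, recvMinus k ω)) μ
  indep_sel_recv : ∀ k, IndepFun (sel k) (fun ω => (recvPlus k ω, recvMinus k ω)) μ

/-- Independent communication: the events `E_k^+` and `E_k^-` are independent for all `k`. -/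
def IndependentCommunication {Ω : Type*} [MeasurableSpace Ω] (μ : Measure Ω)
    (recvPlus recvMinus : ℕ → Ω → Bool) : Prop :=
  ∀ k, IndepSet {ω | recvPlus k ω = true} {ω | recvMinus k ω = true} μ

/-- One meeting: when pair `e = (i, j)` is selected, `i` replaces its state by the average of the
states of `i` and `j` if `p` (it receives the state of `j`), and `j` does so if `m` (it receives
the state of `i`). All other nodes keep their states. -/
noncomputable def meet {n : ℕ} (e : Fin n × Fin n) (p m : Bool) (x : Fin n → ℝ) : Fin n → ℝ :=
  fun l =>
    if (l = e.1 ∧ p = true) ∨ (l = e.2 ∧ m = true) then (x e.1 + x e.2) / 2 else x l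

/-- `state sel recvPlus recvMinus k₀ x⁰ t ω` is the vector of states at time `k₀ + t` when the
algorithm is started at time `k₀` with the states `x⁰`. -/
noncomputable def state {n : ℕ} {Ω : Type*} (sel : ℕ → Ω → Fin n × Fin n)
    (recvPlus recvMinus : ℕ → Ω → Bool) (k₀ : ℕ) (x₀ : Fin n → ℝ) : ℕ → Ω → Fin n → ℝ
  | 0, _ => x₀
  | t + 1, ω => meet (sel (k₀ + t) ω) (recvPlus (k₀ + t) ω) (recvMinus (k₀ + t) ω)
      (state sel recvPlus recvMinus k₀ x₀ t ω)

/-- The consensus metric: largest minus smallest state. -/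
noncomputable def spread {n : ℕ} (x : Fin n → ℝ) : ℝ := (⨆ i, x i) - ⨅ i, x i

/-- The `ε`-computation time, with values in `ℕ ∪ {∞}`: the supremum, over all initial times `k₀`
and all initial conditions at time `k₀` that are not already in consensus, of the smallest `k - k₀`
such that `P (H(k) / H(k₀) ≥ ε) ≤ ε`. -/
noncomputable def compTime {n : ℕ} {Ω : Type*} [MeasurableSpace Ω] (μ : Measure Ω)
    (sel : ℕ → Ω → Fin n × Fin n) (recvPlus recvMinus : ℕ → Ω → Bool) (ε : ℝ) : ℕ∞ :=
  ⨆ (k₀ : ℕ) (x₀ : Fin n → ℝ) (_ : 0 < spread x₀),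
    ⨅ (t : ℕ) (_ : μ.real {ω | ε ≤ spread (state sel recvPlus recvMinus k₀ x₀ t ω) / spread x₀}
      ≤ ε), (t : ℕ∞)

/-- Global a.s. `ε`-consensus: the `ε`-computation time is of the order of `log ε⁻¹` as `ε` tends
to `0` from above, in the sense that the upper limit of the ratio is finite and nonzero. -/
def EpsConsensus {n : ℕ} {Ω : Type*} [MeasurableSpace Ω] (μ : Measure Ω)
    (sel : ℕ → Ω → Fin n × Fin n) (recvPlus recvMinus : ℕ → Ω → Bool) : Prop :=
  limsup (fun ε : ℝ => (compTime μ sel recvPlus recvMinus ε : ℝ≥0∞) /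
      ENNReal.ofReal (Real.log ε⁻¹)) (𝓝[>] 0) < ∞ ∧
  limsup (fun ε : ℝ => (compTime μ sel recvPlus recvMinus ε : ℝ≥0∞) /
      ENNReal.ofReal (Real.log ε⁻¹)) (𝓝[>] 0) ≠ 0

/-- Every window of `T` consecutive terms of `Pplus k + Pminus k` sums to at least `p`. -/
def WindowBound (Pplus Pminus : ℕ → ℝ) (p : ℝ) (T : ℕ) : Prop :=
  ∀ m : ℕ, p ≤ ∑ k ∈ Finset.Ico m (m + T), (Pplus k + Pminus k)

end Gossip

/-!
Given which nodes receive at which times, the selected pairs are still independent, and only the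
meetings in which something is communicated matter. They form words whose letters say whether the
first node, the second node, or both receive, and `wordAvg` is the expectation over the selected
pairs along such a word.

*Contraction.* Starting from a center `c` of the underlying graph and a center `c'` of its converse,
grow two sets of nodes whose states keep a margin from one end of the range of the initial states
(`HasMargin`). A meeting in which the first node receives can add a node to the first set, any other
meeting one to the second set, if the right pair is selected, which has probability at least
`a_* / n`; every meeting at most halves the margins. After `2 n - 3` meetings or more, one of the
sets is exhausted, whatever the order of the letters, so that the spread has decreased
(`wordAvg_spread_le_sub`). As `2 n - 3 ≤ θ₀`, a block of `θ₀` meetings multiplies the expected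
spread by at most `1 - (a_* / 2n) ^ θ₀ / 2`. At time `k`, something is communicated with probability
at least `(P_k^+ + P_k^-) / 2`; averaging over the words gives exponential decay of the expected
spread in the sum of these numbers (`pow_mul_wordAvg_gossipAvg_spread_le`), and Markov's inequality
bounds the computation time (`IsGossipProcess.exists_compTime_eq`). The gap between
`(a_* / 2n) ^ θ₀` and `(a_* / 4n) ^ θ₀` absorbs all losses.

*Lower bound.* Among three nodes, one lies outside a pair of nodes with extremal states. A meeting
that involves it at most halves the spread, so that the spread after `t` steps is at least
`2 ^ (-t)` times the initial one with probability at least `(a_* / n) ^ t` (`pow_le_gossipAvg`). Hence the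
computation time is never less than a multiple of `log ε⁻¹`.

*Necessity.* In a window of length `T_com(ε)`, nothing at all may be communicated with probability
more than `ε`, if `ε < 1`. A union bound then gives the window bound with `p = 1 - ε`
(`IsGossipProcess.windowBound_of_compTime_le`).
-/

namespace Gossip

/-! ### The spread and single meetings -/

section Spread

variable {n : ℕ}

lemma le_iSup_coord (x : Fin n → ℝ) (i : Fin n) : x i ≤ ⨆ j, x j :=
  le_ciSup (Set.finite_range x).bddAbove i

lemma iInf_coord_le (x : Fin n → ℝ) (i : Fin n) : ⨅ j, x j ≤ x i :=
  ciInf_le (Set.finite_range x).bddBelow i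

lemma sub_le_spread (x : Fin n → ℝ) (i j : Fin n) : x i - x j ≤ spread x :=
  sub_le_sub (le_iSup_coord x i) (iInf_coord_le x j)

lemma spread_le_of_bounds [NeZero n] {x : Fin n → ℝ} {m M : ℝ}
    (hx : ∀ i, x i ∈ Set.Icc m M) : spread x ≤ M - m :=
  sub_le_sub (ciSup_le fun i => (hx i).2) (le_ciInf fun i => (hx i).1)

lemma exists_spread_eq [NeZero n] (x : Fin n → ℝ) : ∃ u v, spread x = x u - x v := by
  obtain ⟨u, hu⟩ := exists_eq_ciSup_of_finite (f := x)
  obtain ⟨v, hv⟩ := exists_eq_ciInf_of_finite (f := x)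
  exact ⟨u, v, by rw [spread, hu, hv]⟩

lemma spread_nonneg [NeZero n] (x : Fin n → ℝ) : 0 ≤ spread x := by
  simpa using sub_le_spread x 0 0

lemma meet_false_false (e : Fin n × Fin n) (x : Fin n → ℝ) : meet e false false x = x := by
  funext l; simp [meet]

lemma meet_mem_Icc {x : Fin n → ℝ} {m M : ℝ} (hx : ∀ i, x i ∈ Set.Icc m M) (e : Fin n × Fin n)
    (p q : Bool) (i : Fin n) : meet e p q x i ∈ Set.Icc m M := by
  have h1 := hx e.1
  have h2 := hx e.2
  unfold meet
  split_ifs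
  · exact ⟨by linarith [h1.1, h2.1], by linarith [h1.2, h2.2]⟩
  · exact hx i

lemma spread_meet_le [NeZero n] (e : Fin n × Fin n) (p q : Bool) (x : Fin n → ℝ) :
    spread (meet e p q x) ≤ spread x :=
  spread_le_of_bounds fun i =>
    meet_mem_Icc (fun j => ⟨iInf_coord_le x j, le_iSup_coord x j⟩) e p q i

/-- A meeting that involves a node `w` outside an extremal pair `u`, `v` at most halves the spread,
whatever is communicated, since one of `u` and `v` keeps its state. -/
lemma half_spread_le_spread_meet {x : Fin n → ℝ} {u v : Fin n} (huv : spread x = x u - x v)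
    {e : Fin n × Fin n} {w : Fin n} (hwu : w ≠ u) (hwv : w ≠ v) (he : e.1 = w ∨ e.2 = w)
    (p q : Bool) : spread x / 2 ≤ spread (meet e p q x) := by
  have hmin : ∀ i, x u - x i ≤ x u - x v := fun i => huv ▸ sub_le_spread x u i
  have hmax : ∀ i, x i - x v ≤ x u - x v := fun i => huv ▸ sub_le_spread x i v
  obtain ⟨e1, e2⟩ := e
  have key := sub_le_spread (meet (e1, e2) p q x) u v
  have h1 := hmin e1
  have h2 := hmin e2
  have h3 := hmax e1
  have h4 := hmax e2
  have h5 := hmin u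
  refine le_trans ?_ key
  rcases eq_or_ne u v with rfl | hne
  · rw [huv, sub_self, zero_div, sub_self]
  rw [huv]
  by_cases hu : u = e1 ∨ u = e2
  · -- the meeting involves `u`, so that `v` keeps its state
    have hv : meet (e1, e2) p q x v = x v := by
      unfold meet
      rw [if_neg]
      simp only at he ⊢
      rintro (⟨h, -⟩ | ⟨h, -⟩) <;> rcases hu with rfl | rfl <;> rcases he with rfl | rfl <;>
        simp_all
    rw [hv]
    unfold meet
    simp only
    split_ifs
    · rcases hu with rfl | rfl <;> linarith
    · linarith
  · have hu' : meet (e1, e2) p q x u = x u := by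
      unfold meet
      rw [if_neg]
      simp only
      tauto
    rw [hu']
    unfold meet
    simp only
    split_ifs with h
    · rcases h with ⟨rfl, -⟩ | ⟨rfl, -⟩ <;> linarith
    · linarith

/-- The states in `I` keep a distance of at least `δ` from the upper end of the interval `[m, M]`,
or all of them keep this distance from its lower end. -/
def HasMargin (x : Fin n → ℝ) (m M δ : ℝ) (I : Finset (Fin n)) : Prop :=
  (∀ i ∈ I, x i ≤ M - δ) ∨ (∀ i ∈ I, m + δ ≤ x i)

/-- A meeting at most halves the margin, and a node that receives a state from `I` acquires it. -/
lemma HasMargin.meet_insert {x : Fin n → ℝ} {m M δ : ℝ} {I : Finset (Fin n)}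
    (h : HasMargin x m M δ I) (hδ : 0 ≤ δ) (hx : ∀ i, x i ∈ Set.Icc m M) {e : Fin n × Fin n}
    {p q : Bool} {l : Fin n}
    (hl : l ∈ I ∨ (l = e.1 ∧ p = true ∧ e.2 ∈ I) ∨ (l = e.2 ∧ q = true ∧ e.1 ∈ I)) :
    HasMargin (meet e p q x) m M (δ / 2) (insert l I) := by
  have h1 := hx e.1
  have h2 := hx e.2
  rcases h with h | h
  · left
    intro i hi
    have hi' : i ∈ I ∨ (i = e.1 ∧ p = true ∧ e.2 ∈ I) ∨ (i = e.2 ∧ q = true ∧ e.1 ∈ I) := by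
      rcases Finset.mem_insert.1 hi with rfl | hi
      exacts [hl, Or.inl hi]
    unfold meet
    split_ifs with hc
    · have : e.1 ∈ I ∨ e.2 ∈ I := by
        rcases hi' with hi' | hi' | hi'
        · rcases hc with ⟨rfl, -⟩ | ⟨rfl, -⟩
          exacts [Or.inl hi', Or.inr hi']
        · exact Or.inr hi'.2.2
        · exact Or.inl hi'.2.2
      rcases this with h' | h' <;> linarith [h _ h', h1.2, h2.2]
    · have : i ∈ I := by tauto
      linarith [h _ this]
  · right
    intro i hi
    have hi' : i ∈ I ∨ (i = e.1 ∧ p = true ∧ e.2 ∈ I) ∨ (i = e.2 ∧ q = true ∧ e.1 ∈ I) := by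
      rcases Finset.mem_insert.1 hi with rfl | hi
      exacts [hl, Or.inl hi]
    unfold meet
    split_ifs with hc
    · have : e.1 ∈ I ∨ e.2 ∈ I := by
        rcases hi' with hi' | hi' | hi'
        · rcases hc with ⟨rfl, -⟩ | ⟨rfl, -⟩
          exacts [Or.inl hi', Or.inr hi']
        · exact Or.inr hi'.2.2
        · exact Or.inl hi'.2.2
      rcases this with h' | h' <;> linarith [h _ h', h1.1, h2.1]
    · have : i ∈ I := by tauto
      linarith [h _ this]

lemma HasMargin.spread_le [NeZero n] {x : Fin n → ℝ} {m M δ : ℝ}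
    (h : HasMargin x m M δ Finset.univ) (hx : ∀ i, x i ∈ Set.Icc m M) :
    spread x ≤ M - m - δ := by
  rcases h with h | h
  · have := spread_le_of_bounds (x := x) (m := m) (M := M - δ)
      fun i => ⟨(hx i).1, h i (Finset.mem_univ i)⟩
    linarith
  · have := spread_le_of_bounds (x := x) (m := m + δ) (M := M)
      fun i => ⟨h i (Finset.mem_univ i), (hx i).2⟩
    linarith

end Spread

/-! ### Directed graphs -/

section Digraphs

variable {V : Type*} {G : Digraph V}

lemma ArcPath.exists_adj_crossing {i j : V} {k : ℕ} (p : ArcPath G i j k) {s : Set V}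
    (hi : i ∈ s) (hj : j ∉ s) : ∃ u ∈ s, ∃ v ∉ s, G.Adj u v := by
  induction p with
  | nil => exact absurd hi hj
  | @cons i l _ _ h _ ih =>
    by_cases hl : l ∈ s
    · exact ih hl hj
    · exact ⟨i, hi, l, hl, h⟩

lemma exists_adj_crossing_of_center {c : V} (hc : ∀ j, Reachable G c j) {s : Set V} (hcs : c ∈ s)
    {w : V} (hw : w ∉ s) : ∃ u ∈ s, ∃ v ∉ s, G.Adj u v :=
  (hc w).elim fun _ p => p.exists_adj_crossing hcs hw

/-- In a quasi-strongly connected graph with at least two nodes, each node has an arc to or from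
another one. -/
lemma QuasiStronglyConnected.exists_incident [Nontrivial V] (hG : QuasiStronglyConnected G)
    (w : V) : ∃ u, u ≠ w ∧ (G.Adj u w ∨ G.Adj w u) := by
  obtain ⟨c, hc⟩ := hG
  by_cases h : c = w
  · obtain ⟨v, hv⟩ := exists_ne w
    obtain ⟨u, hu, v, hv, huv⟩ := exists_adj_crossing_of_center hc (s := {w}) h (w := v) hv
    rw [Set.mem_singleton_iff] at hu
    exact ⟨v, hv, Or.inr (hu ▸ huv)⟩
  · obtain ⟨u, hu, v, hv, huv⟩ :=
      exists_adj_crossing_of_center hc (s := {w}ᶜ) h (w := w) (by simp)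
    rw [Set.notMem_compl_iff, Set.mem_singleton_iff] at hv
    exact ⟨u, hu, Or.inl (hv ▸ huv)⟩

lemma dist_le_diam [Fintype V] {i j : V} (h : Reachable G i j) : dist G i j ≤ diam G := by
  classical
  unfold diam
  exact Finset.le_sup (f := fun e : V × V => dist G e.1 e.2) (b := (i, j)) (by simpa using h)

lemma dist_pos {i j : V} (h : Reachable G i j) (hij : i ≠ j) : 0 < dist G i j := by
  have hm : ArcPath G i j (dist G i j) := Nat.sInf_mem (s := {k | ArcPath G i j k}) h
  rcases Nat.eq_zero_or_pos (dist G i j) with h0 | h0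
  · rw [h0] at hm
    cases hm
    exact absurd rfl hij
  · exact h0

end Digraphs

section Parameters

variable {n : ℕ} {A : Matrix (Fin n) (Fin n) ℝ}

lemma finite_offDiag_entries (A : Matrix (Fin n) (Fin n) ℝ) :
    {a | ∃ i j, i ≠ j ∧ 0 < A i j ∧ a = A i j}.Finite := by
  refine (Set.finite_range fun e : Fin n × Fin n => A e.1 e.2).subset ?_
  rintro _ ⟨i, j, -, -, rfl⟩
  exact ⟨(i, j), rfl⟩

lemma aStar_le {i j : Fin n} (hij : i ≠ j) (h : 0 < A i j) : aStar A ≤ A i j :=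
  csInf_le (finite_offDiag_entries A).bddBelow ⟨i, j, hij, h, rfl⟩

lemma aStar_pos {i j : Fin n} (hij : i ≠ j) (h : 0 < A i j) : 0 < aStar A := by
  have hne : {a | ∃ i j, i ≠ j ∧ 0 < A i j ∧ a = A i j}.Nonempty := ⟨_, i, j, hij, h, rfl⟩
  obtain ⟨i', j', -, h', he⟩ := hne.csInf_mem (finite_offDiag_entries A)
  rw [aStar, he]
  exact h'

lemma one_le_dStar (hn : 2 ≤ n) (hG : QuasiStronglyConnected (inducedGraph A)) :
    1 ≤ dStar A := by
  obtain ⟨c, hc⟩ := hG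
  have : Nontrivial (Fin n) := Fin.nontrivial_iff_two_le.2 hn
  obtain ⟨v, hv⟩ := exists_ne c
  exact (dist_pos (hc v) hv.symm).trans_le ((dist_le_diam (hc v)).trans (le_max_left _ _))

/-- A quasi-strongly connected graph has at least `n - 1` arcs, since every node other than the
center has an incoming arc. -/
lemma le_eStar_add_one (hG : QuasiStronglyConnected (inducedGraph A)) : n ≤ eStar A + 1 := by
  classical
  obtain ⟨c, hc⟩ := hG
  have h : ∀ v : Fin n, v ≠ c → ∃ u, u ≠ v ∧ (inducedGraph A).Adj u v := by
    intro v hv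
    obtain ⟨u, hu, v', hv', huv⟩ :=
      exists_adj_crossing_of_center hc (s := {v}ᶜ) (by simpa using hv.symm) (w := v) (by simp)
    rw [Set.notMem_compl_iff, Set.mem_singleton_iff] at hv'
    exact ⟨u, hu, hv' ▸ huv⟩
  choose! f hf using h
  have hcard : (Finset.univ.erase c).card ≤ eStar A := by
    unfold eStar
    refine Finset.card_le_card_of_injOn (fun v => (f v, v)) ?_ ?_
    · intro v hv
      have hv' := hf v (by simpa using hv)
      simpa using ⟨hv'.2, hv'.1⟩
    · intro v _ v' _ h
      exact (Prod.ext_iff.1 h).2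
  rw [Finset.card_erase_of_mem (Finset.mem_univ c), Finset.card_univ, Fintype.card_fin] at hcard
  omega

lemma le_thetaZero (hn : 2 ≤ n) (hG : QuasiStronglyConnected (inducedGraph A)) :
    2 * n ≤ thetaZero A + 3 := by
  have h1 := one_le_dStar hn hG
  have h2 := le_eStar_add_one hG
  have h3 : 2 * eStar A - 1 ≤ thetaZero A := Nat.le_mul_of_pos_left _ (by omega)
  omega

end Parameters

/-! ### Averaging over the selected pairs, given the communication events -/

section Averages

variable {n : ℕ} {A : Matrix (Fin n) (Fin n) ℝ}

/-- The expectation of `f` after one meeting from the states `x`, when the pair is selected at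
random and the communication events are given by `c`. -/
noncomputable def selAvg (A : Matrix (Fin n) (Fin n) ℝ) (c : Bool × Bool)
    (f : (Fin n → ℝ) → ℝ) (x : Fin n → ℝ) : ℝ :=
  ∑ e : Fin n × Fin n, 1 / (n : ℝ) * A e.1 e.2 * f (meet e c.1 c.2 x)

/-- The expectation of `f` after a sequence of meetings from the states `x`, with independently
selected pairs, when the communication events are given by the word `w`, first meeting first. -/
noncomputable def wordAvg (A : Matrix (Fin n) (Fin n) ℝ) :
    List (Bool × Bool) → ((Fin n → ℝ) → ℝ) → (Fin n → ℝ) → ℝ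
  | [], f => f
  | c :: w, f => selAvg A c (wordAvg A w f)

lemma weight_nonneg (hA : A ∈ Matrix.rowStochastic ℝ (Fin n)) (e : Fin n × Fin n) :
    0 ≤ 1 / (n : ℝ) * A e.1 e.2 :=
  mul_nonneg (by positivity) (Matrix.nonneg_of_mem_rowStochastic hA)

lemma sum_weight [NeZero n] (hA : A ∈ Matrix.rowStochastic ℝ (Fin n)) :
    ∑ e : Fin n × Fin n, 1 / (n : ℝ) * A e.1 e.2 = 1 := by
  rw [← Finset.mul_sum, Fintype.sum_prod_type]
  simp [Matrix.sum_row_of_mem_rowStochastic hA, NeZero.ne]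

lemma selAvg_mono (hA : A ∈ Matrix.rowStochastic ℝ (Fin n)) (c : Bool × Bool)
    {f g : (Fin n → ℝ) → ℝ} (h : ∀ x, f x ≤ g x) (x : Fin n → ℝ) :
    selAvg A c f x ≤ selAvg A c g x :=
  Finset.sum_le_sum fun e _ => mul_le_mul_of_nonneg_left (h _) (weight_nonneg hA e)

lemma wordAvg_mono (hA : A ∈ Matrix.rowStochastic ℝ (Fin n)) (w : List (Bool × Bool))
    {f g : (Fin n → ℝ) → ℝ} (h : ∀ x, f x ≤ g x) (x : Fin n → ℝ) :
    wordAvg A w f x ≤ wordAvg A w g x := by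
  induction w generalizing x with
  | nil => exact h x
  | cons c w ih => exact selAvg_mono hA c ih x

lemma selAvg_const_mul (c : Bool × Bool) (r : ℝ) (f : (Fin n → ℝ) → ℝ) (x : Fin n → ℝ) :
    selAvg A c (fun y => r * f y) x = r * selAvg A c f x := by
  unfold selAvg
  rw [Finset.mul_sum]
  exact Finset.sum_congr rfl fun e _ => by ring

lemma wordAvg_const_mul (w : List (Bool × Bool)) (r : ℝ) (f : (Fin n → ℝ) → ℝ)
    (x : Fin n → ℝ) : wordAvg A w (fun y => r * f y) x = r * wordAvg A w f x := by
  induction w generalizing x with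
  | nil => rfl
  | cons c w ih =>
    simp only [wordAvg]
    rw [← selAvg_const_mul, funext ih]

lemma wordAvg_sum {ι : Type*} (s : Finset ι) (w : List (Bool × Bool))
    (f : ι → (Fin n → ℝ) → ℝ) (x : Fin n → ℝ) :
    wordAvg A w (fun y => ∑ i ∈ s, f i y) x = ∑ i ∈ s, wordAvg A w (f i) x := by
  induction w generalizing x with
  | nil => rfl
  | cons c w ih =>
    simp only [wordAvg]
    rw [funext ih]
    unfold selAvg
    simp_rw [Finset.mul_sum]
    exact Finset.sum_comm

lemma wordAvg_append (w w' : List (Bool × Bool)) (f : (Fin n → ℝ) → ℝ) :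
    wordAvg A (w ++ w') f = wordAvg A w (wordAvg A w' f) := by
  induction w with
  | nil => rfl
  | cons c w ih => rw [List.cons_append, wordAvg, wordAvg, ih]

lemma selAvg_false_false [NeZero n] (hA : A ∈ Matrix.rowStochastic ℝ (Fin n))
    (f : (Fin n → ℝ) → ℝ) : selAvg A (false, false) f = f := by
  funext x
  simp only [selAvg, meet_false_false]
  rw [← Finset.sum_mul, sum_weight hA, one_mul]

lemma selAvg_le_sub [NeZero n] (hA : A ∈ Matrix.rowStochastic ℝ (Fin n)) {c : Bool × Bool}
    {f : (Fin n → ℝ) → ℝ} {x : Fin n → ℝ} {K g b : ℝ} (hK : ∀ e, f (meet e c.1 c.2 x) ≤ K)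
    {e₀ : Fin n × Fin n} (h₀ : f (meet e₀ c.1 c.2 x) ≤ K - g) (hg : 0 ≤ g)
    (hb : b ≤ 1 / (n : ℝ) * A e₀.1 e₀.2) : selAvg A c f x ≤ K - b * g := by
  have h1 : ∑ e : Fin n × Fin n, 1 / (n : ℝ) * A e.1 e.2 * (K - f (meet e c.1 c.2 x)) =
      K - selAvg A c f x := by
    simp_rw [mul_sub]
    rw [Finset.sum_sub_distrib, ← Finset.sum_mul, sum_weight hA, one_mul, selAvg]
  have h2 := Finset.single_le_sum
    (f := fun e : Fin n × Fin n => 1 / (n : ℝ) * A e.1 e.2 * (K - f (meet e c.1 c.2 x)))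
    (fun e _ => mul_nonneg (weight_nonneg hA e) (sub_nonneg.2 (hK e))) (Finset.mem_univ e₀)
  have h3 : b * g ≤ 1 / (n : ℝ) * A e₀.1 e₀.2 * (K - f (meet e₀ c.1 c.2 x)) :=
    mul_le_mul hb (by linarith) hg (weight_nonneg hA e₀)
  simp only [h1] at h2
  linarith

lemma selAvg_le [NeZero n] (hA : A ∈ Matrix.rowStochastic ℝ (Fin n)) {c : Bool × Bool}
    {f : (Fin n → ℝ) → ℝ} {x : Fin n → ℝ} {K : ℝ} (hK : ∀ e, f (meet e c.1 c.2 x) ≤ K) :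
    selAvg A c f x ≤ K := by
  simpa using selAvg_le_sub hA hK (e₀ := (0, 0)) (g := 0) (b := 0) (by simpa using hK (0, 0))
    le_rfl (weight_nonneg hA _)

lemma mul_le_selAvg (hA : A ∈ Matrix.rowStochastic ℝ (Fin n)) {c : Bool × Bool}
    {f : (Fin n → ℝ) → ℝ} (hf : ∀ y, 0 ≤ f y) {x : Fin n → ℝ} {g b : ℝ}
    {e₀ : Fin n × Fin n} (h₀ : g ≤ f (meet e₀ c.1 c.2 x)) (hg : 0 ≤ g)
    (hb : b ≤ 1 / (n : ℝ) * A e₀.1 e₀.2) : b * g ≤ selAvg A c f x := by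
  refine (mul_le_mul hb h₀ hg (weight_nonneg hA e₀)).trans ?_
  exact Finset.single_le_sum
    (f := fun e : Fin n × Fin n => 1 / (n : ℝ) * A e.1 e.2 * f (meet e c.1 c.2 x))
    (fun e _ => mul_nonneg (weight_nonneg hA e) (hf _)) (Finset.mem_univ e₀)

lemma wordAvg_spread_le [NeZero n] (hA : A ∈ Matrix.rowStochastic ℝ (Fin n))
    (w : List (Bool × Bool)) (x : Fin n → ℝ) : wordAvg A w spread x ≤ spread x := by
  induction w generalizing x with
  | nil => exact le_rfl
  | cons c w ih => exact selAvg_le hA fun e => (ih _).trans (spread_meet_le e _ _ x)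

/-! ### Contraction of the expected spread -/

/-- Any sufficiently long word of meetings in which something is communicated shrinks the expected
spread. The sets `I` and `J` contain the centers `c`, `c'` of the underlying graph and of its
converse. A meeting in which the first node receives lets `I` grow, if a suitable pair is selected;
any other meeting lets `J` grow. When one of the sets is exhausted, its margin bounds the
spread. -/
lemma wordAvg_spread_le_sub [NeZero n] (hA : A ∈ Matrix.rowStochastic ℝ (Fin n)) {a : ℝ}
    (ha : 0 ≤ a) (han : a ≤ n) (haA : ∀ i j, i ≠ j → 0 < A i j → a ≤ A i j) {c c' : Fin n}
    (hc : ∀ j, Reachable (inducedGraph A) c j)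
    (hc' : ∀ j, Reachable (converse (inducedGraph A)) c' j)
    (w : List (Bool × Bool)) (hw : (false, false) ∉ w) {x : Fin n → ℝ} {m M δ : ℝ} (hδ : 0 ≤ δ)
    (hx : ∀ i, x i ∈ Set.Icc m M) {I J : Finset (Fin n)} (hcI : c ∈ I) (hcJ : c' ∈ J)
    (hI : HasMargin x m M δ I) (hJ : HasMargin x m M δ J)
    (hcard : 2 * n ≤ I.card + J.card + w.length + 1) :
    wordAvg A w spread x ≤ M - m - (a / (2 * n)) ^ w.length * δ := by
  have hn : (0 : ℝ) < n := Nat.cast_pos.2 (NeZero.pos n)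
  have hb0 : 0 ≤ a / (2 * n) := by positivity
  have hb1 : a / (2 * n) ≤ 1 := by rw [div_le_one (by positivity)]; linarith
  -- if one of the sets is exhausted, no further meeting is needed
  have hexhaust : ∀ (w : List (Bool × Bool)) {x : Fin n → ℝ} {δ : ℝ}, 0 ≤ δ →
      (∀ i, x i ∈ Set.Icc m M) → HasMargin x m M δ Finset.univ →
      wordAvg A w spread x ≤ M - m - (a / (2 * n)) ^ w.length * δ := by
    intro w x δ hδ hx h
    have h1 := h.spread_le hx
    have h2 : (a / (2 * n)) ^ w.length * δ ≤ δ := mul_le_of_le_one_left hδ (pow_le_one₀ hb0 hb1)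
    linarith [wordAvg_spread_le hA w x]
  induction w generalizing x δ I J with
  | nil =>
    have hIc : I.card ≤ n := by simpa using I.card_le_univ
    have hJc : J.card ≤ n := by simpa using J.card_le_univ
    simp only [List.length_nil] at hcard
    rcases hIc.eq_or_lt with h | h
    · exact hexhaust [] hδ hx ((Finset.card_eq_iff_eq_univ I).1 (by simpa using h) ▸ hI)
    · have h : J.card = n := by omega
      exact hexhaust [] hδ hx ((Finset.card_eq_iff_eq_univ J).1 (by simpa using h) ▸ hJ)
  | cons τ w ih =>
    by_cases hIu : I = Finset.univ
    · exact hexhaust _ hδ hx (hIu ▸ hI)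
    by_cases hJu : J = Finset.univ
    · exact hexhaust _ hδ hx (hJu ▸ hJ)
    rw [List.mem_cons, not_or] at hw
    rw [List.length_cons] at hcard
    -- the selection of one particular pair suffices
    suffices h : ∃ e₀ : Fin n × Fin n, a ≤ A e₀.1 e₀.2 ∧
        wordAvg A w spread (meet e₀ τ.1 τ.2 x) ≤ M - m - (a / (2 * n)) ^ w.length * (δ / 2) by
      obtain ⟨e₀, he₀, hstep⟩ := h
      have h1 := selAvg_le_sub hA (c := τ) (f := wordAvg A w spread) (x := x) (K := M - m)
        (b := 1 / n * a)
        (fun e => (wordAvg_spread_le hA w _).trans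
          ((spread_meet_le e _ _ x).trans (spread_le_of_bounds hx)))
        hstep (by positivity) (by gcongr)
      refine h1.trans_eq ?_
      rw [List.length_cons, pow_succ]
      field_simp
    cases hp : τ.1 with
    | true =>
      obtain ⟨w₀, hw₀⟩ : ∃ v, v ∉ I := by simpa [Finset.eq_univ_iff_forall] using hIu
      obtain ⟨j, hj, i, hi, hij⟩ :=
        exists_adj_crossing_of_center hc (s := (I : Set (Fin n))) hcI (w := w₀) hw₀
      rw [Finset.mem_coe] at hj hi
      refine ⟨(i, j), haA i j (fun h => hi (h ▸ hj)) hij, ?_⟩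
      refine ih hw.2 (by linarith) (meet_mem_Icc hx _ _ _) (I := insert i I) (J := insert c' J)
        (Finset.mem_insert_of_mem hcI) (Finset.mem_insert_self _ _)
        (hI.meet_insert (e := (i, j)) hδ hx (Or.inr (Or.inl ⟨rfl, rfl, hj⟩)))
        (hJ.meet_insert hδ hx (Or.inl hcJ)) ?_
      rw [Finset.card_insert_of_notMem hi, Finset.insert_eq_of_mem hcJ]
      omega
    | false =>
      have hq : τ.2 = true := by
        by_contra h
        exact hw.1 (Prod.ext hp (by simpa using h)).symm
      obtain ⟨w₀, hw₀⟩ : ∃ v, v ∉ J := by simpa [Finset.eq_univ_iff_forall] using hJu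
      obtain ⟨i, hi, j, hj, hij⟩ :=
        exists_adj_crossing_of_center hc' (s := (J : Set (Fin n))) hcJ (w := w₀) hw₀
      rw [Finset.mem_coe] at hj hi
      refine ⟨(i, j), haA i j (fun h => hj (h ▸ hi)) hij, ?_⟩
      refine ih hw.2 (by linarith) (meet_mem_Icc hx _ _ _) (I := insert c I) (J := insert j J)
        (Finset.mem_insert_self _ _) (Finset.mem_insert_of_mem hcJ)
        (hI.meet_insert hδ hx (Or.inl hcI))
        (hJ.meet_insert (e := (i, j)) hδ hx (Or.inr (Or.inr ⟨rfl, hq, hi⟩))) ?_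
      rw [Finset.card_insert_of_notMem hj, Finset.insert_eq_of_mem hcI]
      omega

/-- The contraction of the expected spread in one block of `θ` meetings with communication. -/
lemma wordAvg_spread_le_mul [NeZero n] (hA : A ∈ Matrix.rowStochastic ℝ (Fin n)) {a : ℝ}
    (ha : 0 ≤ a) (han : a ≤ n) (haA : ∀ i j, i ≠ j → 0 < A i j → a ≤ A i j)
    (hconn : DoublyConnected A) {w : List (Bool × Bool)} (hw : (false, false) ∉ w)
    (hlen : 2 * n ≤ w.length + 3) (x : Fin n → ℝ) :
    wordAvg A w spread x ≤ (1 - (a / (2 * n)) ^ w.length / 2) * spread x := by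
  obtain ⟨⟨c, hc⟩, ⟨c', hc'⟩⟩ := hconn
  have hmargin : ∀ i, HasMargin x (⨅ j, x j) (⨆ j, x j) (spread x / 2) {i} := by
    intro i
    rcases le_total (x i) (((⨅ j, x j) + ⨆ j, x j) / 2) with h | h
    · left
      simp only [Finset.mem_singleton, forall_eq, spread]
      linarith
    · right
      simp only [Finset.mem_singleton, forall_eq, spread]
      linarith
  have := wordAvg_spread_le_sub hA ha han haA hc hc' w hw (div_nonneg (spread_nonneg x) zero_le_two)
    (fun i => ⟨iInf_coord_le x i, le_iSup_coord x i⟩) (Finset.mem_singleton_self c)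
    (Finset.mem_singleton_self c') (hmargin c) (hmargin c') (by simpa using by omega)
  refine this.trans_eq ?_
  rw [← spread]
  ring

/-- Contraction at a constant rate `r` per meeting with communication, up to an incomplete block
of `θ` meetings at the end. -/
lemma pow_mul_wordAvg_spread_le [NeZero n] (hA : A ∈ Matrix.rowStochastic ℝ (Fin n)) {r : ℝ}
    (hr0 : 0 ≤ r) (hr1 : r ≤ 1) {θ : ℕ} (hθ : 0 < θ)
    (hblock : ∀ w : List (Bool × Bool), (false, false) ∉ w → w.length = θ → ∀ x,
      wordAvg A w spread x ≤ r ^ θ * spread x)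
    (w : List (Bool × Bool)) (hw : (false, false) ∉ w) (x : Fin n → ℝ) :
    r ^ θ * wordAvg A w spread x ≤ r ^ w.length * spread x := by
  induction hl : w.length using Nat.strong_induction_on generalizing w with
  | _ l ih =>
    subst hl
    rcases lt_or_ge w.length θ with hlt | hge
    · exact mul_le_mul (pow_le_pow_of_le_one hr0 hr1 hlt.le) (wordAvg_spread_le hA w x)
        (by
          -- nonnegativity, by monotonicity and comparison with the zero function
          have := wordAvg_mono hA w (f := fun _ => 0 * 0) (g := spread)
            (fun y => by simpa using spread_nonneg y) x
          rwa [wordAvg_const_mul, zero_mul] at this) (by positivity)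
    · -- split off the last block
      obtain ⟨w₁, w₂, rfl, h₂⟩ : ∃ w₁ w₂, w = w₁ ++ w₂ ∧ w₂.length = θ :=
        ⟨w.take (w.length - θ), w.drop (w.length - θ), (List.take_append_drop _ _).symm,
          by rw [List.length_drop]; omega⟩
      rw [List.mem_append, not_or] at hw
      rw [List.length_append, h₂, pow_add, wordAvg_append]
      have h1 := wordAvg_mono hA w₁ (hblock w₂ hw.2 h₂) x
      rw [wordAvg_const_mul] at h1
      have h3 := ih w₁.length (by rw [List.length_append]; omega) w₁ hw.1 rfl
      calc r ^ θ * wordAvg A w₁ (wordAvg A w₂ spread) x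
          ≤ r ^ θ * (r ^ θ * wordAvg A w₁ spread x) :=
            mul_le_mul_of_nonneg_left h1 (by positivity)
        _ ≤ r ^ θ * (r ^ w₁.length * spread x) := mul_le_mul_of_nonneg_left h3 (by positivity)
        _ = r ^ w₁.length * r ^ θ * spread x := by ring

end Averages

/-! ### Averaging over the selected pairs and the communication events -/

section Expectation

variable {n : ℕ} {A : Matrix (Fin n) (Fin n) ℝ} {Pplus Pminus : ℕ → ℝ}

/-- The probability of the communication events `c`, if the two events are independent with
probabilities `α` and `β`. -/
noncomputable def commProb (α β : ℝ) (c : Bool × Bool) : ℝ :=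
  (if c.1 then α else 1 - α) * if c.2 then β else 1 - β

/-- The expectation of `f` after `t` steps from the states `x` at time `k`, as an iterated finite
sum. The recursion splits off the first step. -/
noncomputable def gossipAvg (A : Matrix (Fin n) (Fin n) ℝ) (Pplus Pminus : ℕ → ℝ)
    (f : (Fin n → ℝ) → ℝ) : ℕ → ℕ → (Fin n → ℝ) → ℝ
  | 0, _, x => f x
  | t + 1, k, x =>
    ∑ c : Bool × Bool, commProb (Pplus k) (Pminus k) c *
      selAvg A c (gossipAvg A Pplus Pminus f t (k + 1)) x

lemma commProb_nonneg {α β : ℝ} (hα : α ∈ Set.Icc (0 : ℝ) 1) (hβ : β ∈ Set.Icc (0 : ℝ) 1)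
    (c : Bool × Bool) : 0 ≤ commProb α β c := by
  have := hα.1
  have := sub_nonneg.2 hα.2
  have := hβ.1
  have := sub_nonneg.2 hβ.2
  unfold commProb
  split_ifs <;> positivity

lemma sum_commProb (α β : ℝ) : ∑ c : Bool × Bool, commProb α β c = 1 := by
  simp [Fintype.sum_prod_type, commProb]
  ring

lemma gossipAvg_mono (hA : A ∈ Matrix.rowStochastic ℝ (Fin n))
    (hPplus : ∀ k, Pplus k ∈ Set.Icc (0 : ℝ) 1) (hPminus : ∀ k, Pminus k ∈ Set.Icc (0 : ℝ) 1)
    {f g : (Fin n → ℝ) → ℝ} (h : ∀ x, f x ≤ g x) (t k : ℕ) (x : Fin n → ℝ) :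
    gossipAvg A Pplus Pminus f t k x ≤ gossipAvg A Pplus Pminus g t k x := by
  induction t generalizing k x with
  | zero => exact h x
  | succ t ih =>
    exact Finset.sum_le_sum fun c _ => mul_le_mul_of_nonneg_left
      (selAvg_mono hA c (fun y => ih (k + 1) y) x) (commProb_nonneg (hPplus k) (hPminus k) c)

lemma gossipAvg_const_mul (r : ℝ) (f : (Fin n → ℝ) → ℝ) (t k : ℕ) (x : Fin n → ℝ) :
    gossipAvg A Pplus Pminus (fun y => r * f y) t k x = r * gossipAvg A Pplus Pminus f t k x := by
  induction t generalizing k x with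
  | zero => rfl
  | succ t ih =>
    simp only [gossipAvg]
    rw [funext (ih (k + 1)), Finset.mul_sum]
    refine Finset.sum_congr rfl fun c _ => ?_
    rw [selAvg_const_mul]
    ring

lemma gossipAvg_nonneg (hA : A ∈ Matrix.rowStochastic ℝ (Fin n))
    (hPplus : ∀ k, Pplus k ∈ Set.Icc (0 : ℝ) 1) (hPminus : ∀ k, Pminus k ∈ Set.Icc (0 : ℝ) 1)
    {f : (Fin n → ℝ) → ℝ} (h : ∀ x, 0 ≤ f x) (t k : ℕ) (x : Fin n → ℝ) :
    0 ≤ gossipAvg A Pplus Pminus f t k x := by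
  have := gossipAvg_mono hA hPplus hPminus (f := fun y => 0 * f y) (g := f)
    (fun y => by simpa using h y) t k x
  rwa [gossipAvg_const_mul, zero_mul] at this

lemma gossipAvg_succ [NeZero n] (hA : A ∈ Matrix.rowStochastic ℝ (Fin n))
    (f : (Fin n → ℝ) → ℝ) (t k : ℕ) (x : Fin n → ℝ) :
    gossipAvg A Pplus Pminus f (t + 1) k x =
      commProb (Pplus k) (Pminus k) (false, false) * gossipAvg A Pplus Pminus f t (k + 1) x +
      ∑ c ∈ Finset.univ.erase (false, false), commProb (Pplus k) (Pminus k) c *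
        selAvg A c (gossipAvg A Pplus Pminus f t (k + 1)) x := by
  rw [gossipAvg, ← Finset.add_sum_erase _ _ (Finset.mem_univ (false, false)),
    selAvg_false_false hA]

/-- The contraction rate `r` per meeting with communication carries over to the unconditional
expectation. At time `k`, something is communicated with probability at least
`(P_k^+ + P_k^-) / 2`. The word `w` stands for meetings that took place before. -/
lemma pow_mul_wordAvg_gossipAvg_spread_le [NeZero n] (hA : A ∈ Matrix.rowStochastic ℝ (Fin n))
    (hPplus : ∀ k, Pplus k ∈ Set.Icc (0 : ℝ) 1) (hPminus : ∀ k, Pminus k ∈ Set.Icc (0 : ℝ) 1)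
    {r : ℝ} (hr0 : 0 ≤ r) (hr1 : r ≤ 1) {θ : ℕ}
    (hword : ∀ w : List (Bool × Bool), (false, false) ∉ w → ∀ x,
      r ^ θ * wordAvg A w spread x ≤ r ^ w.length * spread x)
    (t k : ℕ) (w : List (Bool × Bool)) (hw : (false, false) ∉ w) (x : Fin n → ℝ) :
    r ^ θ * wordAvg A w (gossipAvg A Pplus Pminus spread t k) x ≤
      r ^ w.length *
        Real.exp (-((1 - r) / 2 * ∑ i ∈ Finset.Ico k (k + t), (Pplus i + Pminus i))) *
          spread x := by
  induction t generalizing k w with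
  | zero =>
    have h0 : gossipAvg A Pplus Pminus spread 0 k = spread := rfl
    simpa [h0] using hword w hw x
  | succ t ih =>
    set S := ∑ i ∈ Finset.Ico (k + 1) (k + 1 + t), (Pplus i + Pminus i) with hS
    have hsum : ∑ i ∈ Finset.Ico k (k + (t + 1)), (Pplus i + Pminus i) =
        Pplus k + Pminus k + S := by
      rw [Finset.sum_eq_sum_Ico_succ_bot (by omega), hS, show k + (t + 1) = k + 1 + t by ring]
    set E := Real.exp (-((1 - r) / 2 * S)) with hE
    have hE0 : 0 < E := Real.exp_pos _
    have hsp := spread_nonneg x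
    set b := commProb (Pplus k) (Pminus k) (false, false) with hb
    have hb' : b ≤ 1 - (Pplus k + Pminus k) / 2 := by
      have : b = (1 - Pplus k) * (1 - Pminus k) := by simp [hb, commProb]
      obtain ⟨h1, h2⟩ := hPplus k
      obtain ⟨h3, h4⟩ := hPminus k
      nlinarith
    have hrest : ∑ c ∈ Finset.univ.erase (false, false), commProb (Pplus k) (Pminus k) c =
        1 - b := by
      rw [← sum_commProb (Pplus k) (Pminus k),
        ← Finset.add_sum_erase _ _ (Finset.mem_univ (false, false))]
      ring
    have hsplit : wordAvg A w (gossipAvg A Pplus Pminus spread (t + 1) k) x =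
        b * wordAvg A w (gossipAvg A Pplus Pminus spread t (k + 1)) x +
        ∑ c ∈ Finset.univ.erase (false, false), commProb (Pplus k) (Pminus k) c *
          wordAvg A (w ++ [c]) (gossipAvg A Pplus Pminus spread t (k + 1)) x := by
      have h0 : gossipAvg A Pplus Pminus spread (t + 1) k = fun y =>
          ∑ c, commProb (Pplus k) (Pminus k) c *
            selAvg A c (gossipAvg A Pplus Pminus spread t (k + 1)) y := rfl
      rw [h0, wordAvg_sum, ← Finset.add_sum_erase _ _ (Finset.mem_univ (false, false)),
        wordAvg_const_mul, selAvg_false_false hA]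
      congr 1
      refine Finset.sum_congr rfl fun c _ => ?_
      rw [wordAvg_const_mul, wordAvg_append]
      rfl
    have hbound : ∀ c ∈ Finset.univ.erase (false, false),
        r ^ θ * wordAvg A (w ++ [c]) (gossipAvg A Pplus Pminus spread t (k + 1)) x ≤
          r ^ w.length * r * E * spread x := by
      intro c hc
      have := ih (k + 1) (w ++ [c]) (by
        rw [List.mem_append, not_or]
        exact ⟨hw, by simpa using (Finset.ne_of_mem_erase hc).symm⟩)
      simpa [pow_succ] using this
    have hexp : b + (1 - b) * r ≤ Real.exp (-((1 - r) / 2 * (Pplus k + Pminus k))) := by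
      have := Real.add_one_le_exp (-((1 - r) / 2 * (Pplus k + Pminus k)))
      nlinarith
    calc r ^ θ * wordAvg A w (gossipAvg A Pplus Pminus spread (t + 1) k) x
        = b * (r ^ θ * wordAvg A w (gossipAvg A Pplus Pminus spread t (k + 1)) x) +
          ∑ c ∈ Finset.univ.erase (false, false), commProb (Pplus k) (Pminus k) c *
            (r ^ θ * wordAvg A (w ++ [c]) (gossipAvg A Pplus Pminus spread t (k + 1)) x) := by
          rw [hsplit, mul_add, Finset.mul_sum]
          congr 1
          · ring
          · exact Finset.sum_congr rfl fun c _ => by ring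
      _ ≤ b * (r ^ w.length * E * spread x) +
          ∑ c ∈ Finset.univ.erase (false, false), commProb (Pplus k) (Pminus k) c *
            (r ^ w.length * r * E * spread x) := by
          refine add_le_add (mul_le_mul_of_nonneg_left (ih (k + 1) w hw)
            (commProb_nonneg (hPplus k) (hPminus k) _)) (Finset.sum_le_sum fun c hc =>
              mul_le_mul_of_nonneg_left (hbound c hc) (commProb_nonneg (hPplus k) (hPminus k) _))
      _ = (b + (1 - b) * r) * (r ^ w.length * E * spread x) := by
          rw [← Finset.sum_mul, hrest]
          ring
      _ ≤ Real.exp (-((1 - r) / 2 * (Pplus k + Pminus k))) * (r ^ w.length * E * spread x) :=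
          mul_le_mul_of_nonneg_right hexp (by positivity)
      _ = _ := by
          rw [hsum, mul_add ((1 - r) / 2) _ S, neg_add, Real.exp_add]
          ring

/-- Within `t` steps, nothing is communicated with probability at least
`1 - ∑ (P_k^+ + P_k^-)`. -/
lemma le_gossipAvg_of_eq_one [NeZero n] (hA : A ∈ Matrix.rowStochastic ℝ (Fin n))
    (hPplus : ∀ k, Pplus k ∈ Set.Icc (0 : ℝ) 1) (hPminus : ∀ k, Pminus k ∈ Set.Icc (0 : ℝ) 1)
    {f : (Fin n → ℝ) → ℝ} (hf : ∀ x, 0 ≤ f x) {x : Fin n → ℝ} (hx : f x = 1) (t k : ℕ) :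
    1 - ∑ i ∈ Finset.Ico k (k + t), (Pplus i + Pminus i) ≤ gossipAvg A Pplus Pminus f t k x := by
  induction t generalizing k with
  | zero => simp [gossipAvg, hx]
  | succ t ih =>
    set S := ∑ i ∈ Finset.Ico (k + 1) (k + 1 + t), (Pplus i + Pminus i) with hS
    have hsum : ∑ i ∈ Finset.Ico k (k + (t + 1)), (Pplus i + Pminus i) =
        Pplus k + Pminus k + S := by
      rw [Finset.sum_eq_sum_Ico_succ_bot (by omega), hS, show k + (t + 1) = k + 1 + t by ring]
    have hg := ih (k + 1)
    have hg0 := gossipAvg_nonneg hA hPplus hPminus hf t (k + 1) x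
    have hS0 : 0 ≤ S := Finset.sum_nonneg fun i _ => add_nonneg (hPplus i).1 (hPminus i).1
    have hrest : 0 ≤ ∑ c ∈ Finset.univ.erase (false, false), commProb (Pplus k) (Pminus k) c *
        selAvg A c (gossipAvg A Pplus Pminus f t (k + 1)) x :=
      Finset.sum_nonneg fun c _ => mul_nonneg (commProb_nonneg (hPplus k) (hPminus k) c)
        (Finset.sum_nonneg fun e _ => mul_nonneg (weight_nonneg hA e)
          (gossipAvg_nonneg hA hPplus hPminus hf _ _ _))
    have hb : commProb (Pplus k) (Pminus k) (false, false) = (1 - Pplus k) * (1 - Pminus k) := by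
      simp [commProb]
    obtain ⟨h1, h2⟩ := hPplus k
    obtain ⟨h3, h4⟩ := hPminus k
    rw [gossipAvg_succ hA, hsum, hb]
    have h5 : 0 ≤ (1 - Pplus k) * (1 - Pminus k) :=
      mul_nonneg (sub_nonneg.2 h2) (sub_nonneg.2 h4)
    rw [← hS] at hg
    nlinarith [mul_le_mul_of_nonneg_left hg h5, mul_nonneg h1 h3,
      mul_nonneg (mul_nonneg h1 (sub_nonneg.2 h4)) hS0, mul_nonneg h3 hS0]

/-- The spread survives `t` steps up to the factor `2 ^ t` with probability at least `b ^ t`: at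
each step it suffices that the selected pair involves a node outside an extremal pair, whose
existence needs at least three nodes. -/
lemma pow_le_gossipAvg (hn : 3 ≤ n) (hA : A ∈ Matrix.rowStochastic ℝ (Fin n))
    (hPplus : ∀ k, Pplus k ∈ Set.Icc (0 : ℝ) 1) (hPminus : ∀ k, Pminus k ∈ Set.Icc (0 : ℝ) 1)
    {b : ℝ} (hb0 : 0 ≤ b) (hb : ∀ i j, i ≠ j → 0 < A i j → b ≤ 1 / (n : ℝ) * A i j)
    (hG : QuasiStronglyConnected (inducedGraph A)) (t k : ℕ) {s : ℝ} {x : Fin n → ℝ}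
    (hx : 2 ^ t * s ≤ spread x) :
    b ^ t ≤ gossipAvg A Pplus Pminus ({y | s ≤ spread y}.indicator 1) t k x := by
  have : NeZero n := ⟨by omega⟩
  have : Nontrivial (Fin n) := Fin.nontrivial_iff_two_le.2 (by omega)
  have hf : ∀ y : Fin n → ℝ, 0 ≤ Set.indicator {y | s ≤ spread y} (1 : (Fin n → ℝ) → ℝ) y :=
    fun y => Set.indicator_nonneg (fun _ _ => zero_le_one) y
  induction t generalizing k x with
  | zero =>
    rw [pow_zero, one_mul] at hx
    rw [gossipAvg, Set.indicator_of_mem (by exact hx)]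
    simp
  | succ t ih =>
    obtain ⟨u, v, huv⟩ := exists_spread_eq x
    obtain ⟨w, hw⟩ : ∃ w, w ∉ ({u, v} : Finset (Fin n)) := by
      refine Finset.exists_mem_notMem_of_card_lt_card (s := {u, v}) (t := Finset.univ) ?_ |>.imp
        fun _ h => h.2
      rw [Finset.card_univ, Fintype.card_fin]
      exact (Finset.card_le_two).trans_lt (by omega)
    simp only [Finset.mem_insert, Finset.mem_singleton, not_or] at hw
    obtain ⟨e, he, hbe⟩ : ∃ e : Fin n × Fin n, (e.1 = w ∨ e.2 = w) ∧
        b ≤ 1 / (n : ℝ) * A e.1 e.2 := by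
      obtain ⟨l, hl, h | h⟩ := hG.exists_incident w
      · exact ⟨(w, l), Or.inl rfl, hb _ _ hl.symm h⟩
      · exact ⟨(l, w), Or.inr rfl, hb _ _ hl h⟩
    rw [gossipAvg, ← one_mul (b ^ (t + 1)), ← sum_commProb (Pplus k) (Pminus k), Finset.sum_mul]
    refine Finset.sum_le_sum fun c _ => mul_le_mul_of_nonneg_left ?_
      (commProb_nonneg (hPplus k) (hPminus k) c)
    rw [pow_succ']
    refine mul_le_selAvg hA (gossipAvg_nonneg hA hPplus hPminus hf _ _) (e₀ := e)
      (ih (k + 1) ?_) (by positivity) hbe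
    have := half_spread_le_spread_meet huv hw.1 hw.2 he c.1 c.2
    rw [pow_succ] at hx
    linarith

end Expectation

/-! ### The distribution of the states -/

section States

variable {n : ℕ} {Ω : Type*} {sel : ℕ → Ω → Fin n × Fin n} {recvPlus recvMinus : ℕ → Ω → Bool}

lemma state_succ_eq (k t : ℕ) (x : Fin n → ℝ) (ω : Ω) :
    state sel recvPlus recvMinus k x (t + 1) ω =
      state sel recvPlus recvMinus (k + 1)
        (meet (sel k ω) (recvPlus k ω) (recvMinus k ω) x) t ω := by
  induction t with
  | zero => rfl
  | succ t ih =>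
    rw [state, ih, state, show k + (t + 1) = k + 1 + t by ring]

/-- The states depend only on the meetings between the initial time and the current one. -/
lemma state_congr {Ω' : Type*} {sel' : ℕ → Ω' → Fin n × Fin n}
    {recvPlus' recvMinus' : ℕ → Ω' → Bool}
    (k t : ℕ) (x : Fin n → ℝ) {ω : Ω} {ω' : Ω'}
    (h : ∀ i ∈ Finset.Ico k (k + t), sel i ω = sel' i ω' ∧ recvPlus i ω = recvPlus' i ω' ∧
      recvMinus i ω = recvMinus' i ω') :
    state sel recvPlus recvMinus k x t ω = state sel' recvPlus' recvMinus' k x t ω' := by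
  induction t with
  | zero => rfl
  | succ t ih =>
    obtain ⟨h1, h2, h3⟩ := h (k + t) (by simp)
    rw [state, state, h1, h2, h3, ih fun i hi => h i (by simp at hi ⊢; omega)]

lemma setOf_state_succ (k t : ℕ) (x : Fin n → ℝ) (S : Set (Fin n → ℝ)) :
    {ω | state sel recvPlus recvMinus k x (t + 1) ω ∈ S} =
      ⋃ z : (Fin n × Fin n) × Bool × Bool,
        (fun ω => (sel k ω, recvPlus k ω, recvMinus k ω)) ⁻¹' {z} ∩
          {ω | state sel recvPlus recvMinus (k + 1) (meet z.1 z.2.1 z.2.2 x) t ω ∈ S} := by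
  ext ω
  simp only [Set.mem_ofPred_eq, Set.mem_iUnion, Set.mem_inter_iff, Set.mem_preimage,
    Set.mem_singleton_iff, state_succ_eq]
  exact ⟨fun h => ⟨_, rfl, h⟩, by rintro ⟨z, rfl, h⟩; exact h⟩

end States

section Distribution

variable {n : ℕ} {A : Matrix (Fin n) (Fin n) ℝ} {Pplus Pminus : ℕ → ℝ}
  {Ω : Type*} [MeasurableSpace Ω] {μ : Measure Ω}
  {sel : ℕ → Ω → Fin n × Fin n} {recvPlus recvMinus : ℕ → Ω → Bool}

lemma IsGossipProcess.measurable_meeting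
    (hproc : IsGossipProcess A Pplus Pminus μ sel recvPlus recvMinus) (k : ℕ) :
    Measurable fun ω => (sel k ω, recvPlus k ω, recvMinus k ω) :=
  (hproc.measurable_sel k).prodMk ((hproc.measurable_recvPlus k).prodMk
    (hproc.measurable_recvMinus k))

/-- No measurability of `S` is needed, since the state takes finitely many values. -/
lemma IsGossipProcess.measurableSet_state
    (hproc : IsGossipProcess A Pplus Pminus μ sel recvPlus recvMinus) (S : Set (Fin n → ℝ))
    (t k : ℕ) (x : Fin n → ℝ) :
    MeasurableSet {ω | state sel recvPlus recvMinus k x t ω ∈ S} := by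
  induction t generalizing k x with
  | zero => exact MeasurableSet.const (x ∈ S)
  | succ t ih =>
    rw [setOf_state_succ]
    exact MeasurableSet.iUnion fun z =>
      (hproc.measurable_meeting k (measurableSet_singleton z)).inter (ih _ _)

/-- A meeting is independent of what the later ones make of given states. -/
lemma IsGossipProcess.measureReal_meeting_inter_state
    (hproc : IsGossipProcess A Pplus Pminus μ sel recvPlus recvMinus) (hn : 0 < n) (k t : ℕ)
    (x : Fin n → ℝ) (S : Set (Fin n → ℝ)) (z : (Fin n × Fin n) × Bool × Bool) :
    μ.real ((fun ω => (sel k ω, recvPlus k ω, recvMinus k ω)) ⁻¹' {z} ∩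
        {ω | state sel recvPlus recvMinus (k + 1) x t ω ∈ S}) =
      μ.real ((fun ω => (sel k ω, recvPlus k ω, recvMinus k ω)) ⁻¹' {z}) *
        μ.real {ω | state sel recvPlus recvMinus (k + 1) x t ω ∈ S} := by
  set I := Finset.Ico (k + 1) (k + 1 + t)
  have hfin := hproc.indep_time.indepFun_finset {k} I (by simp [I]) hproc.measurable_meeting
  -- the state as a function of the tuple of the later meetings
  let ext : (I → (Fin n × Fin n) × Bool × Bool) → ℕ → (Fin n × Fin n) × Bool × Bool :=
    fun u i => if h : i ∈ I then u ⟨i, h⟩ else ((⟨0, hn⟩, ⟨0, hn⟩), false, false)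
  let F : (I → (Fin n × Fin n) × Bool × Bool) → Fin n → ℝ :=
    state (fun i u => (ext u i).1) (fun i u => (ext u i).2.1) (fun i u => (ext u i).2.2)
      (k + 1) x t
  have hF : {ω | state sel recvPlus recvMinus (k + 1) x t ω ∈ S} =
      (fun ω (i : I) => (sel i ω, recvPlus i ω, recvMinus i ω)) ⁻¹' (F ⁻¹' S) := by
    ext ω
    have : state sel recvPlus recvMinus (k + 1) x t ω =
        F fun i : I => (sel i ω, recvPlus i ω, recvMinus i ω) := by
      refine state_congr _ _ _ fun i hi => ?_
      simp only [ext, dif_pos (show i ∈ I from hi), and_self]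
    simp [this]
  have hz : (fun ω => (sel k ω, recvPlus k ω, recvMinus k ω)) ⁻¹' {z} =
      (fun ω (i : ({k} : Finset ℕ)) => (sel i ω, recvPlus i ω, recvMinus i ω)) ⁻¹'
        {u | u ⟨k, Finset.mem_singleton_self k⟩ = z} := by
    ext ω; simp
  rw [hF, hz, measureReal_def, hfin.measure_inter_preimage_eq_mul _ _
    (Set.toFinite _).measurableSet (Set.toFinite _).measurableSet, ENNReal.toReal_mul]
  rfl

variable [IsProbabilityMeasure μ]

lemma measureReal_preimage_bool {g : Ω → Bool} (hg : Measurable g) {α : ℝ}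
    (h : μ.real {ω | g ω = true} = α) (b : Bool) :
    μ.real (g ⁻¹' {b}) = if b then α else 1 - α := by
  cases b with
  | true => exact h
  | false =>
    have hc : g ⁻¹' {false} = (g ⁻¹' {true})ᶜ := by ext ω; simp
    rw [hc, probReal_compl_eq_one_sub (hg (measurableSet_singleton true))]
    exact congrArg (1 - ·) h

/-- The law of a single meeting. -/
lemma IsGossipProcess.measureReal_meeting
    (hproc : IsGossipProcess A Pplus Pminus μ sel recvPlus recvMinus)
    (hindep : IndependentCommunication μ recvPlus recvMinus) (k : ℕ) (e : Fin n × Fin n)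
    (c : Bool × Bool) :
    μ.real ((fun ω => (sel k ω, recvPlus k ω, recvMinus k ω)) ⁻¹' {(e, c)}) =
      1 / (n : ℝ) * A e.1 e.2 * commProb (Pplus k) (Pminus k) c := by
  have h1 := (hproc.indep_sel_recv k).measure_inter_preimage_eq_mul {e} {c}
    (measurableSet_singleton _) (measurableSet_singleton _)
  -- a Boolean map is measurable for the σ-algebra generated by the event that it is `true`
  have hfun : IndepFun (recvPlus k) (recvMinus k) μ := by
    have hle : ∀ g : Ω → Bool, MeasurableSpace.comap g inferInstance ≤
        MeasurableSpace.generateFrom {{ω | g ω = true}} := fun g =>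
      (@measurable_to_bool _ (MeasurableSpace.generateFrom {{ω | g ω = true}}) g
        (MeasurableSpace.measurableSet_generateFrom (Set.mem_singleton _))).comap_le
    exact indep_of_indep_of_le_left (indep_of_indep_of_le_right (hindep k) (hle _)) (hle _)
  have h2 := hfun.measure_inter_preimage_eq_mul {c.1} {c.2}
    (measurableSet_singleton _) (measurableSet_singleton _)
  have hset : (fun ω => (sel k ω, recvPlus k ω, recvMinus k ω)) ⁻¹' {(e, c)} =
      sel k ⁻¹' {e} ∩ (fun ω => (recvPlus k ω, recvMinus k ω)) ⁻¹' {c} := by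
    ext ω; simp [Prod.ext_iff]
  have hset' : (fun ω => (recvPlus k ω, recvMinus k ω)) ⁻¹' {c} =
      recvPlus k ⁻¹' {c.1} ∩ recvMinus k ⁻¹' {c.2} := by
    ext ω; simp [Prod.ext_iff]
  have hsel : μ.real (sel k ⁻¹' {e}) = 1 / (n : ℝ) * A e.1 e.2 := hproc.law_sel k e.1 e.2
  rw [hset, measureReal_def, h1, ENNReal.toReal_mul, hset', h2, ENNReal.toReal_mul, commProb,
    ← measureReal_preimage_bool (hproc.measurable_recvPlus k) (hproc.law_recvPlus k),
    ← measureReal_preimage_bool (hproc.measurable_recvMinus k) (hproc.law_recvMinus k), ← hsel]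
  rfl

/-- The iterated sum `gossipAvg` is the expectation over the gossip process. -/
lemma IsGossipProcess.measureReal_state
    (hproc : IsGossipProcess A Pplus Pminus μ sel recvPlus recvMinus)
    (hindep : IndependentCommunication μ recvPlus recvMinus) (hn : 0 < n) (S : Set (Fin n → ℝ))
    (t k : ℕ) (x : Fin n → ℝ) :
    μ.real {ω | state sel recvPlus recvMinus k x t ω ∈ S} =
      gossipAvg A Pplus Pminus (S.indicator 1) t k x := by
  induction t generalizing k x with
  | zero => by_cases hx : x ∈ S <;> simp [state, gossipAvg, hx]
  | succ t ih =>
    rw [setOf_state_succ, measureReal_iUnion_fintype]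
    · rw [Fintype.sum_prod_type_right, gossipAvg]
      refine Finset.sum_congr rfl fun c _ => ?_
      rw [selAvg, Finset.mul_sum]
      refine Finset.sum_congr rfl fun e _ => ?_
      rw [hproc.measureReal_meeting_inter_state hn, hproc.measureReal_meeting hindep, ih]
      ring
    · intro z z' hzz'
      exact (Disjoint.preimage _ (by simpa using hzz')).mono Set.inter_subset_left
        Set.inter_subset_left
    · exact fun z => (hproc.measurable_meeting k (measurableSet_singleton z)).inter
        (hproc.measurableSet_state S t (k + 1) _)

end Distribution

/-! ### The computation time -/

section CompTime

variable {n : ℕ} {A : Matrix (Fin n) (Fin n) ℝ} {Pplus Pminus : ℕ → ℝ}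
  {Ω : Type*} [MeasurableSpace Ω] {μ : Measure Ω}
  {sel : ℕ → Ω → Fin n × Fin n} {recvPlus recvMinus : ℕ → Ω → Bool}

lemma compTime_le {ε : ℝ} {N : ℕ} (h : ∀ (k : ℕ) (x : Fin n → ℝ), 0 < spread x →
      μ.real {ω | ε ≤ spread (state sel recvPlus recvMinus k x N ω) / spread x} ≤ ε) :
    compTime μ sel recvPlus recvMinus ε ≤ N :=
  iSup_le fun k => iSup_le fun x => iSup_le fun hx => iInf₂_le N (h k x hx)

lemma exists_le_of_compTime_le {ε : ℝ} {N : ℕ} (h : compTime μ sel recvPlus recvMinus ε ≤ N)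
    (k : ℕ) {x : Fin n → ℝ} (hx : 0 < spread x) : ∃ t ≤ N,
      μ.real {ω | ε ≤ spread (state sel recvPlus recvMinus k x t ω) / spread x} ≤ ε := by
  simp only [compTime, iSup_le_iff] at h
  have h1 := h k x hx
  have h2 := h1.trans_lt (show (N : ℕ∞) < ((N + 1 : ℕ) : ℕ∞) by exact_mod_cast N.lt_succ_self)
  simp only [iInf_lt_iff] at h2
  obtain ⟨t, ht, htN⟩ := h2
  exact ⟨t, Nat.lt_succ_iff.1 (by exact_mod_cast htN), ht⟩

lemma exists_spread_pos (hn : 2 ≤ n) : ∃ x : Fin n → ℝ, 0 < spread x := by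
  have h := sub_le_spread (Pi.single (⟨0, by omega⟩ : Fin n) (1 : ℝ)) ⟨0, by omega⟩ ⟨1, by omega⟩
  refine ⟨_, lt_of_lt_of_le ?_ h⟩
  simp

lemma WindowBound.mul_le_sum {p : ℝ} {T : ℕ} (h : WindowBound Pplus Pminus p T) (k j : ℕ) :
    j * p ≤ ∑ i ∈ Finset.Ico k (k + j * T), (Pplus i + Pminus i) := by
  induction j with
  | zero => simp
  | succ j ih =>
    have h1 := h (k + j * T)
    rw [show k + (j + 1) * T = k + j * T + T by ring,
      ← Finset.sum_Ico_consecutive _ (Nat.le_add_right k (j * T)) (Nat.le_add_right _ T)]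
    push_cast
    linarith

variable [IsProbabilityMeasure μ]

lemma IsGossipProcess.measureReal_ratio
    (hproc : IsGossipProcess A Pplus Pminus μ sel recvPlus recvMinus)
    (hindep : IndependentCommunication μ recvPlus recvMinus) (hn : 0 < n) (ε : ℝ) (t k : ℕ)
    {x : Fin n → ℝ} (hx : 0 < spread x) :
    μ.real {ω | ε ≤ spread (state sel recvPlus recvMinus k x t ω) / spread x} =
      gossipAvg A Pplus Pminus ({y | ε * spread x ≤ spread y}.indicator 1) t k x := by
  rw [← hproc.measureReal_state hindep hn]
  simp only [le_div_iff₀ hx, Set.mem_ofPred_eq]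

/-- Finite computation time at a single `ε < 1` forces the window bound. -/
lemma IsGossipProcess.windowBound_of_compTime_le
    (hproc : IsGossipProcess A Pplus Pminus μ sel recvPlus recvMinus)
    (hindep : IndependentCommunication μ recvPlus recvMinus) (hn : 2 ≤ n)
    (hA : A ∈ Matrix.rowStochastic ℝ (Fin n))
    (hPplus : ∀ k, Pplus k ∈ Set.Icc (0 : ℝ) 1) (hPminus : ∀ k, Pminus k ∈ Set.Icc (0 : ℝ) 1)
    {ε : ℝ} (hε : ε < 1) {N : ℕ} (hN : compTime μ sel recvPlus recvMinus ε ≤ N) :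
    WindowBound Pplus Pminus (1 - ε) N := by
  have : NeZero n := ⟨by omega⟩
  intro m
  obtain ⟨x, hx⟩ := exists_spread_pos hn
  obtain ⟨t, htN, ht⟩ := exists_le_of_compTime_le hN m hx
  rw [hproc.measureReal_ratio hindep (by omega) ε t m hx] at ht
  have h1 := le_gossipAvg_of_eq_one (Pplus := Pplus) (Pminus := Pminus) hA hPplus hPminus
    (f := {y | ε * spread x ≤ spread y}.indicator 1)
    (fun y => Set.indicator_nonneg (fun _ _ => zero_le_one) y) (x := x)
    (Set.indicator_of_mem (by
      change ε * spread x ≤ spread x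
      exact mul_le_of_le_one_left hx.le hε.le) _) t m
  have h2 : ∑ i ∈ Finset.Ico m (m + t), (Pplus i + Pminus i) ≤
      ∑ i ∈ Finset.Ico m (m + N), (Pplus i + Pminus i) :=
    Finset.sum_le_sum_of_subset_of_nonneg (Finset.Ico_subset_Ico_right (by omega))
      fun i _ _ => add_nonneg (hPplus i).1 (hPminus i).1
  linarith

lemma aStar_pos_of_connected (hn : 2 ≤ n) (hG : QuasiStronglyConnected (inducedGraph A)) :
    0 < aStar A := by
  have : Nontrivial (Fin n) := Fin.nontrivial_iff_two_le.2 hn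
  obtain ⟨l, hl, h | h⟩ := hG.exists_incident ⟨0, by omega⟩
  exacts [aStar_pos hl.symm h, aStar_pos hl h]

lemma aStar_le_one (hn : 2 ≤ n) (hA : A ∈ Matrix.rowStochastic ℝ (Fin n))
    (hG : QuasiStronglyConnected (inducedGraph A)) : aStar A ≤ 1 := by
  have : Nontrivial (Fin n) := Fin.nontrivial_iff_two_le.2 hn
  obtain ⟨l, hl, h | h⟩ := hG.exists_incident ⟨0, by omega⟩
  exacts [(aStar_le hl.symm h).trans (Matrix.le_one_of_mem_rowStochastic hA),
    (aStar_le hl h).trans (Matrix.le_one_of_mem_rowStochastic hA)]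

/-- The computation time grows at least logarithmically, whatever the communication
probabilities are. -/
lemma IsGossipProcess.log_inv_le_of_compTime_le
    (hproc : IsGossipProcess A Pplus Pminus μ sel recvPlus recvMinus)
    (hindep : IndependentCommunication μ recvPlus recvMinus) (hn : 3 ≤ n)
    (hA : A ∈ Matrix.rowStochastic ℝ (Fin n))
    (hPplus : ∀ k, Pplus k ∈ Set.Icc (0 : ℝ) 1) (hPminus : ∀ k, Pminus k ∈ Set.Icc (0 : ℝ) 1)
    (hG : QuasiStronglyConnected (inducedGraph A)) {ε : ℝ} {N : ℕ}
    (hN : compTime μ sel recvPlus recvMinus ε ≤ N) :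
    Real.log ε⁻¹ ≤ N * Real.log (aStar A / n)⁻¹ := by
  have ha := aStar_pos_of_connected (by omega) hG
  have hn3 : (3 : ℝ) ≤ n := by exact_mod_cast hn
  set b := aStar A / n with hb
  have hb0 : 0 < b := by positivity
  have hb2 : b ≤ 2⁻¹ := by
    rw [hb, div_le_iff₀ (by positivity)]
    linarith [aStar_le_one (by omega) hA hG]
  obtain ⟨x, hx⟩ := exists_spread_pos (n := n) (by omega)
  obtain ⟨t, htN, ht⟩ := exists_le_of_compTime_le hN 0 hx
  rw [hproc.measureReal_ratio hindep (by omega) ε t 0 hx] at ht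
  have hbε : b ^ t ≤ ε := by
    by_cases h : 2 ^ t * ε ≤ 1
    · refine (pow_le_gossipAvg hn hA hPplus hPminus hb0.le ?_ hG t 0 ?_).trans ht
      · intro i j hij h
        rw [hb, div_eq_inv_mul, one_div]
        exact mul_le_mul_of_nonneg_left (aStar_le hij h) (by positivity)
      · rw [← mul_assoc]
        exact mul_le_of_le_one_left hx.le h
    · calc b ^ t ≤ (2⁻¹) ^ t := pow_le_pow_left₀ hb0.le hb2 t
        _ = 1 / 2 ^ t := by rw [inv_pow, one_div]
        _ ≤ ε := by
          rw [div_le_iff₀ (by positivity), mul_comm]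
          exact (not_le.1 h).le
  have h1 := Real.log_le_log (by positivity) hbε
  rw [Real.log_pow] at h1
  have h2 : 0 ≤ Real.log b⁻¹ := Real.log_nonneg (by
    rw [one_le_inv₀ hb0]
    linarith)
  have h3 : (t : ℝ) ≤ N := by exact_mod_cast htN
  have h4 := mul_le_mul_of_nonneg_right h3 h2
  rw [Real.log_inv] at h4 ⊢
  rw [Real.log_inv]
  linarith

/-- The upper bound on the computation time under the window bound. It follows from Markov's
inequality and the exponential decay of the expected spread. -/
lemma IsGossipProcess.exists_compTime_eq
    (hproc : IsGossipProcess A Pplus Pminus μ sel recvPlus recvMinus)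
    (hindep : IndependentCommunication μ recvPlus recvMinus) (hn : 3 ≤ n)
    (hA : A ∈ Matrix.rowStochastic ℝ (Fin n))
    (hPplus : ∀ k, Pplus k ∈ Set.Icc (0 : ℝ) 1) (hPminus : ∀ k, Pminus k ∈ Set.Icc (0 : ℝ) 1)
    (hconn : DoublyConnected A) {p : ℝ} {T : ℕ} (hp : 0 < p)
    (hwin : WindowBound Pplus Pminus p T) :
    ∃ C : ℝ, ∀ ε ∈ Set.Ioo (0 : ℝ) 1, ∃ N : ℕ, compTime μ sel recvPlus recvMinus ε = N ∧
      (N : ℝ) ≤ (4 * T * thetaZero A / p) /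
        Real.log ((1 - (aStar A / (4 * n)) ^ thetaZero A)⁻¹) * Real.log ε⁻¹ + C := by
  have : NeZero n := ⟨by omega⟩
  have hn3 : (3 : ℝ) ≤ n := by exact_mod_cast hn
  have ha0 := aStar_pos_of_connected (by omega) hconn.1
  have ha1 := aStar_le_one (by omega) hA hconn.1
  have hθn := le_thetaZero (by omega) hconn.1
  set a := aStar A
  set θ := thetaZero A
  have hθ : (0 : ℝ) < θ := by exact_mod_cast (show 0 < θ by omega)
  -- `1 - y / 2` is the contraction in a block of `θ` meetings
  set y := (a / (2 * n)) ^ θ with hy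
  have hy0 : 0 < y := by positivity
  have hy1 : y ≤ 1 := pow_le_one₀ (by positivity) (by
    rw [div_le_one (by positivity)]; linarith)
  set c := y / (2 * θ) with hc
  have hc0 : 0 < c := by positivity
  have hc1 : c ≤ 1 / 2 := by
    rw [hc, div_le_iff₀ (by positivity)]
    have : (1 : ℝ) ≤ θ := by exact_mod_cast (show 1 ≤ θ by omega)
    linarith
  -- the rate per meeting loses nothing to first order, by Bernoulli's inequality
  have hr : 1 - y / 2 ≤ (1 - c) ^ θ := by
    have h1 := one_add_mul_le_pow (show (-2 : ℝ) ≤ -c by linarith) θ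
    have h2 : (θ : ℝ) * c = y / 2 := by rw [hc]; field_simp
    have h3 : (1 : ℝ) + -c = 1 - c := by ring
    rw [h3] at h1
    linarith
  have hr0 : 0 < (1 - c) ^ θ := pow_pos (by linarith) θ
  have hdecay : ∀ (t k : ℕ) (x : Fin n → ℝ),
      (1 - c) ^ θ * gossipAvg A Pplus Pminus spread t k x ≤
        Real.exp (-(c / 2 * ∑ i ∈ Finset.Ico k (k + t), (Pplus i + Pminus i))) * spread x := by
    intro t k x
    have hblock : ∀ w : List (Bool × Bool), (false, false) ∉ w → w.length = θ → ∀ x,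
        wordAvg A w spread x ≤ (1 - c) ^ θ * spread x := by
      intro w hw hl x
      have h1 := wordAvg_spread_le_mul hA ha0.le (by linarith)
        (fun i j hij h => aStar_le hij h) hconn hw (by omega) x
      rw [hl] at h1
      exact h1.trans (mul_le_mul_of_nonneg_right hr (spread_nonneg x))
    have h2 := pow_mul_wordAvg_gossipAvg_spread_le hA hPplus hPminus (r := 1 - c) (by linarith)
      (by linarith) (pow_mul_wordAvg_spread_le hA (by linarith) (by linarith) (by omega) hblock)
      t k [] (by simp) x
    simpa [wordAvg] using h2
  -- the comparison of the rates, with room to spare since `θ ≥ 2`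
  have hs : Real.log ((1 - (a / (4 * n)) ^ θ)⁻¹) ≤ θ * c ∧
      0 < Real.log ((1 - (a / (4 * n)) ^ θ)⁻¹) := by
    set s := (a / (4 * n)) ^ θ with hs
    have hs0 : 0 < s := by positivity
    have hys : y = 2 ^ θ * s := by
      rw [hy, hs, ← mul_pow]
      congr 1
      field_simp
      norm_num
    have h4 : (4 : ℝ) ≤ 2 ^ θ := by
      calc (4 : ℝ) = 2 ^ 2 := by norm_num
        _ ≤ 2 ^ θ := pow_le_pow_right₀ (by norm_num) (by omega)
    have hs4 : 4 * s ≤ y := by rw [hys]; exact mul_le_mul_of_nonneg_right h4 hs0.le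
    have h1s : 0 < 1 - s := by linarith
    constructor
    · have h1 := Real.log_le_sub_one_of_pos (inv_pos.2 h1s)
      have h2 : (θ : ℝ) * c = y / 2 := by rw [hc]; field_simp
      have h3 : (1 - s)⁻¹ ≤ 1 + 2 * s := by
        rw [inv_le_iff_one_le_mul₀ h1s]
        nlinarith
      linarith
    · exact Real.log_pos ((one_lt_inv₀ h1s).2 (by linarith))
  set L := Real.log ((1 - (a / (4 * n)) ^ θ)⁻¹)
  set D := -Real.log ((1 - c) ^ θ) with hD
  have hD0 : 0 ≤ D :=
    neg_nonneg.2 (Real.log_nonpos hr0.le (pow_le_one₀ (by linarith) (by linarith)))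
  refine ⟨T * (2 * D / (c * p) + 1), fun ε hε => ?_⟩
  have hε0 := hε.1
  set ℓ := Real.log ε⁻¹ with hℓ
  have hℓ0 : 0 ≤ ℓ := Real.log_nonneg ((one_le_inv₀ hε0).2 hε.2.le)
  -- the number of windows after which the expected spread has decreased by the factor `ε ^ 2`
  set j := ⌈(4 * ℓ + 2 * D) / (c * p)⌉₊ with hj
  have hj1 : (4 * ℓ + 2 * D) / (c * p) ≤ j := Nat.le_ceil _
  have hj2 : (j : ℝ) < (4 * ℓ + 2 * D) / (c * p) + 1 := Nat.ceil_lt_add_one (by positivity)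
  have hle : compTime μ sel recvPlus recvMinus ε ≤ ((j * T : ℕ) : ℕ∞) := by
    refine compTime_le fun k x hx => ?_
    rw [hproc.measureReal_ratio hindep (by omega) ε _ k hx]
    have hmarkov := gossipAvg_mono hA hPplus hPminus
      (f := {y | ε * spread x ≤ spread y}.indicator 1)
      (g := fun y => (ε * spread x)⁻¹ * spread y) (fun y => by
        refine Set.indicator_apply_le' (fun hy => ?_) (fun _ => ?_)
        · rw [Pi.one_apply, inv_mul_eq_div, one_le_div (by positivity)]
          exact hy
        · exact mul_nonneg (by positivity) (spread_nonneg y)) (j * T) k x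
    rw [gossipAvg_const_mul] at hmarkov
    have h1 := hdecay (j * T) k x
    have h2 : Real.exp (-(c / 2 * ∑ i ∈ Finset.Ico k (k + j * T), (Pplus i + Pminus i))) ≤
        (1 - c) ^ θ * ε ^ 2 := by
      have h3 : (1 - c) ^ θ * ε ^ 2 = Real.exp (-(D + 2 * ℓ)) := by
        rw [hD, hℓ, Real.log_inv, ← Real.exp_log (show 0 < (1 - c) ^ θ * ε ^ 2 by positivity),
          Real.log_mul hr0.ne' (by positivity), Real.log_pow ε]
        push_cast
        ring_nf
      rw [h3]
      refine Real.exp_le_exp.2 (neg_le_neg ?_)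
      have h4 := mul_le_mul_of_nonneg_left (hwin.mul_le_sum k j) hc0.le
      rw [div_le_iff₀ (by positivity)] at hj1
      linarith
    have h5 : gossipAvg A Pplus Pminus spread (j * T) k x ≤ ε ^ 2 * spread x := by
      refine le_of_mul_le_mul_left (h1.trans ?_) hr0
      rw [← mul_assoc]
      exact mul_le_mul_of_nonneg_right h2 hx.le
    refine hmarkov.trans ?_
    rw [inv_mul_le_iff₀ (by positivity)]
    linarith
  obtain ⟨N, hN⟩ := ENat.ne_top_iff_exists.1 (ne_top_of_le_ne_top (ENat.natCast_ne_top _) hle)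
  refine ⟨N, hN.symm, ?_⟩
  rw [← hN] at hle
  have hNj : (N : ℝ) ≤ j * T := by exact_mod_cast hle
  have hT0 : (0 : ℝ) ≤ T := Nat.cast_nonneg T
  calc (N : ℝ) ≤ j * T := hNj
    _ ≤ ((4 * ℓ + 2 * D) / (c * p) + 1) * T := mul_le_mul_of_nonneg_right hj2.le hT0
    _ = 4 * T * θ / p / (θ * c) * ℓ + T * (2 * D / (c * p) + 1) := by
      field_simp
      ring
    _ ≤ 4 * T * θ / p / L * ℓ + T * (2 * D / (c * p) + 1) := by
      have := hs.1
      have := hs.2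
      gcongr

end CompTime

end Gossip

open Gossip in
theorem theorem5 {n : ℕ} (hn : 3 ≤ n)
    (A : Matrix (Fin n) (Fin n) ℝ) (hA : A ∈ Matrix.rowStochastic ℝ (Fin n))
    (Pplus Pminus : ℕ → ℝ)
    (hPplus : ∀ k, Pplus k ∈ Set.Icc (0 : ℝ) 1) (hPminus : ∀ k, Pminus k ∈ Set.Icc (0 : ℝ) 1)
    {Ω : Type*} [MeasurableSpace Ω] (μ : Measure Ω) [IsProbabilityMeasure μ]
    (sel : ℕ → Ω → Fin n × Fin n) (recvPlus recvMinus : ℕ → Ω → Bool)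
    (hproc : IsGossipProcess A Pplus Pminus μ sel recvPlus recvMinus)
    (hindep : IndependentCommunication μ recvPlus recvMinus)
    (hconn : DoublyConnected A) :
    (EpsConsensus μ sel recvPlus recvMinus ↔
      ∃ p : ℝ, 0 < p ∧ ∃ T : ℕ, 1 ≤ T ∧ WindowBound Pplus Pminus p T) ∧
    ∀ (p : ℝ) (T : ℕ), 0 < p → 1 ≤ T → WindowBound Pplus Pminus p T →
      ∃ C : ℝ, ∀ ε ∈ Set.Ioo (0 : ℝ) 1, ∃ N : ℕ, compTime μ sel recvPlus recvMinus ε = N ∧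
        (N : ℝ) ≤ (4 * T * thetaZero A / p) /
          Real.log ((1 - (aStar A / (4 * n)) ^ thetaZero A)⁻¹) * Real.log ε⁻¹ + C := by
  have hupper := fun (p : ℝ) (T : ℕ) (hp : 0 < p) (_ : 1 ≤ T)
    (hwin : WindowBound Pplus Pminus p T) =>
      hproc.exists_compTime_eq hindep hn hA hPplus hPminus hconn hp hwin
  refine ⟨⟨fun h => ?_, ?_⟩, hupper⟩
  · have hlt : ∀ᶠ ε : ℝ in 𝓝[>] 0, ε < 1 := nhdsWithin_le_nhds (gt_mem_nhds one_pos)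
    obtain ⟨ε, hfin, hε1⟩ := ((eventually_lt_of_limsup_lt h.1).and hlt).exists
    have hne : compTime μ sel recvPlus recvMinus ε ≠ ⊤ := by
      intro htop
      rw [htop, ENat.toENNReal_top, ENNReal.top_div_of_ne_top ENNReal.ofReal_ne_top] at hfin
      exact lt_irrefl _ hfin
    obtain ⟨N, hN⟩ := ENat.ne_top_iff_exists.1 hne
    have hwin := hproc.windowBound_of_compTime_le hindep (by omega) hA hPplus hPminus hε1 hN.ge
    refine ⟨1 - ε, sub_pos.2 hε1, N, Nat.one_le_iff_ne_zero.2 ?_, hwin⟩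
    rintro rfl
    have := hwin 0
    simp only [add_zero, Finset.Ico_self, Finset.sum_empty] at this
    linarith
  · rintro ⟨p, hp, T, hT, hwin⟩
    -- for `ε < exp (-1)`, the additive constant is at most a multiple of `log ε⁻¹`
    have hsmall : ∀ᶠ ε : ℝ in 𝓝[>] 0, 0 < ε ∧ 1 < Real.log ε⁻¹ := by
      have h1 : ∀ᶠ ε : ℝ in 𝓝[>] 0, ε < Real.exp (-1) :=
        nhdsWithin_le_nhds (gt_mem_nhds (Real.exp_pos _))
      filter_upwards [self_mem_nhdsWithin, h1] with ε hε hε'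
      refine ⟨hε, ?_⟩
      rw [Real.log_inv, lt_neg]
      exact (Real.log_lt_iff_lt_exp hε).2 hε'
    constructor
    · obtain ⟨C, hC⟩ := hupper p T hp hT hwin
      set K := (4 * T * thetaZero A / p) / Real.log ((1 - (aStar A / (4 * n)) ^ thetaZero A)⁻¹)
      refine lt_of_le_of_lt (limsup_le_of_le (by isBoundedDefault) (a := ENNReal.ofReal (K + |C|))
        ?_) ENNReal.ofReal_lt_top
      filter_upwards [hsmall] with ε hε
      have hε1 : ε < 1 := by
        by_contra h
        have := Real.log_nonpos (inv_nonneg.2 hε.1.le) (inv_le_one_of_one_le₀ (not_lt.1 h))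
        linarith [hε.2]
      obtain ⟨N, hN, hNC⟩ := hC ε ⟨hε.1, hε1⟩
      have hbound : (N : ℝ) ≤ (K + |C|) * Real.log ε⁻¹ := by
        have := le_mul_of_one_le_right (abs_nonneg C) hε.2.le
        linarith [le_abs_self C]
      rw [hN, ENat.toENNReal_coe]
      refine ENNReal.div_le_of_le_mul ?_
      rw [← ENNReal.ofReal_mul' (by linarith [hε.2]), ← ENNReal.ofReal_natCast]
      exact ENNReal.ofReal_le_ofReal hbound
    · set L := Real.log (aStar A / n)⁻¹
      have hL : 0 < L := by
        have ha := aStar_pos_of_connected (by omega) hconn.1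
        have ha1 := aStar_le_one (by omega) hA hconn.1
        have hn3 : (3 : ℝ) ≤ n := by exact_mod_cast hn
        refine Real.log_pos ((one_lt_inv₀ (by positivity)).2 ?_)
        rw [div_lt_one (by positivity)]
        linarith
      refine (lt_of_lt_of_le (ENNReal.ofReal_pos.2 (inv_pos.2 hL))
        (le_limsup_of_frequently_le (Eventually.frequently ?_) (by isBoundedDefault))).ne'
      filter_upwards [hsmall] with ε hε
      have hℓ : 0 < Real.log ε⁻¹ := by linarith [hε.2]
      rw [ENNReal.le_div_iff_mul_le (Or.inl (ENNReal.ofReal_pos.2 hℓ).ne')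
        (Or.inl ENNReal.ofReal_ne_top)]
      cases hN : compTime μ sel recvPlus recvMinus ε with
      | top => simp
      | coe N =>
        have := hproc.log_inv_le_of_compTime_le hindep hn hA hPplus hPminus hconn.1 hN.le
        rw [ENat.toENNReal_coe, ← ENNReal.ofReal_mul (inv_pos.2 hL).le,
          ← ENNReal.ofReal_natCast]
        refine ENNReal.ofReal_le_ofReal ?_
        rw [inv_mul_le_iff₀ hL, mul_comm]
        exact this
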